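/- Let $s$ be a target function: to a probability distribution on $\mathbb R$ it assigns a real function on a measurable set $D\subseteq\mathbb R$. Let $X_1,X_2$ be real random variables, let $s_j$ be the value of $s$ at the law of $X_j$, and let $\{X_{j,i}\}_{i\ge1}$, $j=1,2$, be two mutually independent i.i.d. samples from $X_1$ and $X_2$. Let $\hat s_j$ be the plug-in estimator of $s_j$, i.e. the value of $s$ at the empirical distribution of $X_{j,1},\dots,X_{j,n_j}$, and let $\hat s_j^*$ be the value of $s$ at the empirical distribution of a bootstrap sample of size $n_j$ drawn independently from that empirical distribution (independently for $j=1,2$). Assume that $s_1-s_2$, $\hat s_1-\hat s_2$ and $\hat s_1^*-\hat s_2^*$ belong (almost surely) to $\mathrm L^1=\mathrm L^1(D)$ with Lebesgue measure and norm $\|\cdot\|$. Put $\mathcal I(s_1,s_2)=\left(\int_D(s_1-s_2),\int_D|s_1-s_2|\right)$ (the 2DSD index), $g(x,y)=\frac12(1-x/y)$, and $$\varepsilon_0=\inf\Big\{\varepsilon\in[0,1]:\int_{\{s_1<s_2\}}(s_2-s_1)\le\varepsilon\|s_1-s_2\|\Big\}$$ (the minimum violation ratio). Limits are taken as $n_1,n_2\to\infty$,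 possibly along a prescribed sampling scheme, such as a sequence of pairs $(n_1,n_2)$ or the condition $n_1/(n_1+n_2)\to\lambda$. Assume that for some normalization $r_{n_1,n_2}\to\infty$: 1. $r_{n_1,n_2}(\hat s_1-\hat s_2-(s_1-s_2))\rightsquigarrow\mathbb S$ weakly in $\mathrm L^1$, where $\mathbb S=(\mathbb S(t))_{t\in D}$ is a measurable Gaussian process with paths in $\mathrm L^1$ such that no $\mathbb S(t)$ is a.s. equal to a non-zero constant (this always holds if $\mathbb S$ is centred); 2. $\hat s_1-\hat s_2\to s_1-s_2$ in $\mathrm L^1$ almost surely; 3. the bootstrap process is a.s. consistent in $\mathrm L^1$: almost surely, conditionally on the data, $r_{n_1,n_2}(\hat s_1^*-\hat s_2^*-(\hat s_1-\hat s_2))$ converges weakly in $\mathrm L^1$ to $\mathbb S$. Let $D_{\mathbb S}=\{t\in D:\mathrm P(\mathbb S(t)\ne0)>0\}$ be the support of $\mathbb S$. For a function $T$ of the pair of target functions, say that the bootstrap estimator $T(\hat s_1^*,\hat s_2^*)$ is a.s. consistent if $r_{n_1,n_2}(T(\hat s_1,\hat s_2)-T(s_1,s_2))$ converges in distribution and,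 almost surely, the conditional law given the data of $r_{n_1,n_2}(T(\hat s_1^*,\hat s_2^*)-T(\hat s_1,\hat s_2))$ converges weakly to the same limit. Then the following are equivalent: (a) the set $\{t\in D\cap D_{\mathbb S}:s_1(t)=s_2(t)\}$ has Lebesgue measure zero; (b) the bootstrap estimator $\mathcal I(\hat s_1^*,\hat s_2^*)$ of the 2DSD index is a.s. consistent. If these conditions hold and $\varepsilon_0>0$, then the bootstrap estimator $\hat\varepsilon_0^*=g(\mathcal I(\hat s_1^*,\hat s_2^*))$ of $\varepsilon_0$ is also a.s. consistent. -/

import Mathlib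

open MeasureTheory ProbabilityTheory Filter Topology
open scoped ENNReal

namespace StochDom

/-- The space `L¹(D)` of (classes of) Lebesgue integrable functions on `D ⊆ ℝ`. -/
abbrev L1 (D : Set ℝ) : Type := Lp ℝ 1 ((volume : Measure ℝ).restrict D)

/-- `L¹(D)` carries its Borel σ-algebra. -/
noncomputable instance instMeasurableSpaceL1 (D : Set ℝ) : MeasurableSpace (L1 D) := borel _

instance instBorelSpaceL1 (D : Set ℝ) : BorelSpace (L1 D) := ⟨rfl⟩

open Classical in
/-- The element of `L¹(D)` given by a function that is integrable on `D`
(and `0` for all other functions). -/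
noncomputable def toL1 (D : Set ℝ) (f : ℝ → ℝ) : L1 D :=
  if h : Integrable f (volume.restrict D) then h.toL1 f else 0

/-! ### The index and the minimum violation ratio -/

/-- The 2-dimensional stochastic dominance index `(∫_D (s₁ - s₂), ∫_D |s₁ - s₂|)`. -/
noncomputable def index (D : Set ℝ) (s₁ s₂ : ℝ → ℝ) : ℝ × ℝ :=
  (∫ t in D, (s₁ t - s₂ t), ∫ t in D, |s₁ t - s₂ t|)

/-- `X₁ ≼ₛ^ε X₂`: almost stochastic dominance with violation ratio `ε`. -/
def AlmostDominated (D : Set ℝ) (s₁ s₂ : ℝ → ℝ) (ε : ℝ) : Prop :=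
  ∫ t in {t ∈ D | s₁ t < s₂ t}, (s₂ t - s₁ t) ≤ ε * ∫ t in D, |s₁ t - s₂ t|

/-- The minimum violation ratio `ε₀`. -/
noncomputable def mvr (D : Set ℝ) (s₁ s₂ : ℝ → ℝ) : ℝ :=
  sInf {ε ∈ Set.Icc (0 : ℝ) 1 | AlmostDominated D s₁ s₂ ε}

/-- `g(x, y) = (1 - x / y) / 2`. -/
noncomputable def gfun (p : ℝ × ℝ) : ℝ := (1 - p.1 / p.2) / 2

/-! ### Samples, empirical measures and the bootstrap -/

/-- A pair of samples of sizes `n = (n₁, n₂)`. -/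
abbrev SamplePair (n : ℕ+ × ℕ+) : Type := (Fin n.1 → ℝ) × (Fin n.2 → ℝ)

/-- The empirical probability measure of a sample of size `m`
(its distribution function is the empirical distribution function). -/
noncomputable def empirical {m : ℕ+} (x : Fin m → ℝ) : Measure ℝ :=
  (((m : ℕ) : ℝ≥0∞)⁻¹) • ∑ i, Measure.dirac (x i)

instance instIsProbabilityMeasureEmpirical {m : ℕ+} (x : Fin m → ℝ) :
    IsProbabilityMeasure (empirical x) := by
  constructor
  have h0 : ((m : ℕ) : ℝ≥0∞) ≠ 0 := by exact_mod_cast m.ne_zero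
  simp [empirical, ENNReal.inv_mul_cancel h0 (ENNReal.natCast_ne_top _)]

/-- The conditional law, given the pair of samples `x`, of the pair of bootstrap samples:
`n₁` independent draws from the first empirical measure and, independently, `n₂` independent draws
from the second one. -/
noncomputable def bootLaw {n : ℕ+ × ℕ+} (x : SamplePair n) : Measure (SamplePair n) :=
  (Measure.pi fun _ : Fin n.1 => empirical x.1).prod (Measure.pi fun _ : Fin n.2 => empirical x.2)

instance instIsProbabilityMeasureBootLaw {n : ℕ+ × ℕ+} (x : SamplePair n) :
    IsProbabilityMeasure (bootLaw x) := by
  unfold bootLaw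
  infer_instance

/-- The observed samples of sizes `n = (n₁, n₂)`: the first `n₁` observations of the first
population and the first `n₂` observations of the second one. -/
def sample {Ω : Type*} (X₁ X₂ : ℕ → Ω → ℝ) (n : ℕ+ × ℕ+) (ω : Ω) : SamplePair n :=
  (fun i => X₁ i ω, fun i => X₂ i ω)

/-- The value `T(ŝ₁, ŝ₂)` at a pair of samples, where `ŝ₁, ŝ₂` are the plug-in estimators of the
target function `s` (a functional of the probability distribution). -/
noncomputable def plugIn {E : Type*} (s : Measure ℝ → ℝ → ℝ) (T : (ℝ → ℝ) → (ℝ → ℝ) → E)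
    {n : ℕ+ × ℕ+} (x : SamplePair n) : E :=
  T (s (empirical x.1)) (s (empirical x.2))

/-- The difference of two functions. -/
def diff (s₁ s₂ : ℝ → ℝ) : ℝ → ℝ := fun t => s₁ t - s₂ t

/-- The bootstrap estimator `T(ŝ₁*, ŝ₂*)` of `T(s₁, s₂)`, where `sⱼ = s μⱼ`, is a.s. consistent (as
`n → ∞` along the filter `l`, with normalization `r`): the estimator `T(ŝ₁, ŝ₂)` has a limit law `ν`,
i.e. `r (T(ŝ₁, ŝ₂) - T(s₁, s₂)) ⇝ ν`, and, for almost every realization of the data, the conditional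
law given the data of `r (T(ŝ₁*, ŝ₂*) - T(ŝ₁, ŝ₂))` converges weakly to the same `ν`. -/
def IsBootstrapConsistent {E : Type*} [NormedAddCommGroup E] [NormedSpace ℝ E]
    [MeasurableSpace E] [BorelSpace E] {Ω : Type*} [MeasurableSpace Ω]
    (P : Measure Ω) [IsProbabilityMeasure P] (X₁ X₂ : ℕ → Ω → ℝ) (μ₁ μ₂ : Measure ℝ)
    (s : Measure ℝ → ℝ → ℝ) (l : Filter (ℕ+ × ℕ+)) (r : ℕ+ × ℕ+ → ℝ)
    (T : (ℝ → ℝ) → (ℝ → ℝ) → E) : Prop :=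
  ∃ ν : ProbabilityMeasure E,
    TendstoInDistribution
      (fun n ω => r n • (plugIn s T (sample X₁ X₂ n ω) - T (s μ₁) (s μ₂)))
      l id (fun _ => P) (ν : Measure E) ∧
    ∀ᵐ ω ∂P, TendstoInDistribution
      (fun n x => r n • (plugIn s T x - plugIn s T (sample X₁ X₂ n ω)))
      l id (fun n => bootLaw (sample X₁ X₂ n ω)) (ν : Measure E)

/-- The support of a process `S` on `D`: the set of `t ∈ D` such that `S t` is not a.s. zero. -/
def processSupport {Ω' : Type*} [MeasurableSpace Ω'] (Q : Measure Ω') (D : Set ℝ)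
    (S : ℝ → Ω' → ℝ) : Set ℝ :=
  {t ∈ D | ¬ (S t =ᵐ[Q] 0)}

end StochDom

/-! Write `F` for `s₁ - s₂` in `L¹`. The `L¹` norm is Hadamard directionally differentiable at `F`,
with derivative `normDeriv F H`, that is, the integral of `sgn(F) H` over `{F ≠ 0}` plus the
integral of `|H|` over `{F = 0}`. With the fixed center `F`, the extended continuous mapping theorem
therefore always gives the estimated index a limit law.

If the process `W` vanishes on `{F = 0}` (condition (a), after Fubini), the difference quotients
converge even around the moving centers `F̂`, so the same argument works conditionally on the data
and gives (b); this is `tendstoInDistribution_indexL1`.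

For the converse (`normDeriv_additive_of_bootstrap`), split `r (F* - F) = G + H`, with `G = r (F̂ -
F)` depending on the data and `H = r (F* - F̂)` on the resampling. If `h` is in the support of the
law of `W`, then for suitable data `G` is close to `h` infinitely often, and there the bootstrap law
of the norm is close to that of `normDeriv F (h + W) - normDeriv F h`. Consistency forces this to
have the law of `normDeriv F W`; by sublinearity the two variables are ordered, so they agree a.s.
Hence two independent copies of `W` have no opposite signs on `{F = 0}`. A nondegenerate Gaussian
variable charges both half-lines, so `S t` is constant there, hence zero.

The claim on `ε₀` is the delta method for `gfun`, which is smooth where the norm is nonzero. -/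

namespace StochDom

/-! ### Weak convergence: extended continuous mapping, recurrence, delta method. -/

section Weak

variable {ι : Type*} {Ω : ι → Type*} {m : ∀ i, MeasurableSpace (Ω i)}
  {P : (i : ι) → Measure (Ω i)} [∀ i, IsProbabilityMeasure (P i)]
  {Ω' : Type*} {m' : MeasurableSpace Ω'} {Q : Measure Ω'} [IsProbabilityMeasure Q]
  {l : Filter ι} {X E : Type*}

/-- Portmanteau inequality for open sets, for random variables. -/
lemma le_liminf_of_tendstoInDistribution [TopologicalSpace X] [HasOuterApproxClosed X]
    [MeasurableSpace X] [BorelSpace X] {Z : (i : ι) → Ω i → X} {Z' : Ω' → X}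
    (hZ : TendstoInDistribution Z l Z' P Q) {U : Set X} (hU : IsOpen U) :
    Q (Z' ⁻¹' U) ≤ l.liminf fun n => P n (Z n ⁻¹' U) := by
  have h := ProbabilityMeasure.le_liminf_measure_open_of_tendsto hZ.tendsto hU
  simpa only [ProbabilityMeasure.coe_mk, Measure.map_apply_of_aemeasurable hZ.aemeasurable_limit
    hU.measurableSet, Measure.map_apply_of_aemeasurable (hZ.forall_aemeasurable _)
    hU.measurableSet] using h

/-- **Extended continuous mapping theorem**. -/
theorem tendstoInDistribution_of_tendsto_prod [l.IsCountablyGenerated]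
    [TopologicalSpace X] [HasOuterApproxClosed X] [MeasurableSpace X] [BorelSpace X]
    [TopologicalSpace E] [HasOuterApproxClosed E] [MeasurableSpace E] [BorelSpace E]
    {Z : (i : ι) → Ω i → X} {Z' : Ω' → X} (hZ : TendstoInDistribution Z l Z' P Q)
    {Y : (i : ι) → Ω i → E} {Y' : Ω' → E} (hY : ∀ i, AEMeasurable (Y i) (P i))
    (hY' : AEMeasurable Y' Q) (Θ : ι → X → E)
    (hΘ : ∀ᶠ i in l, ∀ᵐ ω ∂(P i), Y i ω = Θ i (Z i ω))
    (hlim : ∀ᵐ ω ∂Q, Tendsto (fun p : ι × X => Θ p.1 p.2) (l ×ˢ 𝓝 (Z' ω)) (𝓝 (Y' ω))) :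
    TendstoInDistribution Y l Y' P Q := by
  refine ⟨hY, hY', tendsto_of_forall_isOpen_le_liminf' fun G hG => ?_⟩
  simp only [ProbabilityMeasure.coe_mk, Measure.map_apply_of_aemeasurable hY' hG.measurableSet,
    Measure.map_apply_of_aemeasurable (hY _) hG.measurableSet]
  obtain ⟨B, hB⟩ := l.exists_antitone_basis
  -- Points near which every map with index in `B N` lands in `G`. These open sets increase and, by
  -- `hlim`, cover almost all of the event `Y' ∈ G`, so portmanteau can be applied to each of them.
  set U : ℕ → Set X := fun N => interior {z | ∀ n ∈ B N, Θ n z ∈ G} with hUdef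
  have hmono : Monotone U := fun N M hNM => interior_mono fun z hz n hn => hz n (hB.2 hNM hn)
  have h1 : Q (Y' ⁻¹' G) ≤ Q (⋃ N, Z' ⁻¹' U N) := by
    refine measure_mono_ae ?_
    filter_upwards [hlim] with ω hω hωG
    have h2 := hω (hG.mem_nhds hωG)
    rw [mem_map, (hB.1.prod (𝓝 (Z' ω)).basis_sets).mem_iff] at h2
    obtain ⟨⟨N, V⟩, ⟨-, hV⟩, hsub⟩ := h2
    refine Set.mem_iUnion.2 ⟨N, mem_interior_iff_mem_nhds.2 (mem_of_superset hV ?_)⟩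
    exact fun z hz n hn => hsub (Set.mk_mem_prod hn hz)
  refine h1.trans ?_
  rw [Monotone.measure_iUnion fun N M hNM => Set.preimage_mono (hmono hNM)]
  refine iSup_le fun N => (le_liminf_of_tendstoInDistribution hZ isOpen_interior).trans ?_
  refine liminf_le_liminf ?_
  filter_upwards [hΘ, hB.1.mem_of_mem trivial (i := N)] with n hn hnB
  refine measure_mono_ae ?_
  filter_upwards [hn] with ω hω hωU
  have := interior_subset hωU n hnB
  change Y n ω ∈ G
  rwa [hω]

/-- Replacing the limiting random variable by the identity on its law. -/
lemma tendstoInDistribution_id_iff [TopologicalSpace E] [MeasurableSpace E] [BorelSpace E]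
    {Y : (i : ι) → Ω i → E} {Y' : Ω' → E} (hY' : AEMeasurable Y' Q)
    [IsProbabilityMeasure (Q.map Y')] :
    TendstoInDistribution Y l id P (Q.map Y') ↔ TendstoInDistribution Y l Y' P Q := by
  constructor
  · intro h
    refine ⟨h.1, hY', ?_⟩
    simpa only [Measure.map_id] using h.3
  · intro h
    refine ⟨h.1, aemeasurable_id, ?_⟩
    simpa only [Measure.map_id] using h.3

/-- Convergence in distribution, tested on the bounded continuous function `arctan`. -/
lemma tendsto_integral_arctan {Y : (i : ι) → Ω i → ℝ} {Y' : Ω' → ℝ}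
    (hY : TendstoInDistribution Y l Y' P Q) :
    Tendsto (fun n => ∫ ω, Real.arctan (Y n ω) ∂(P n)) l (𝓝 (∫ ω, Real.arctan (Y' ω) ∂Q)) := by
  let b : BoundedContinuousFunction ℝ ℝ := BoundedContinuousFunction.ofNormedAddCommGroup
    Real.arctan Real.continuous_arctan (Real.pi / 2) fun x => by
      rw [Real.norm_eq_abs, abs_le]
      exact ⟨(Real.neg_pi_div_two_lt_arctan x).le, (Real.arctan_lt_pi_div_two x).le⟩
  have h := (ProbabilityMeasure.tendsto_iff_forall_integral_tendsto.1 hY.tendsto) b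
  simp only [ProbabilityMeasure.coe_mk] at h
  rw [integral_map hY.aemeasurable_limit b.continuous.aestronglyMeasurable] at h
  refine h.congr fun n => ?_
  rw [integral_map (hY.forall_aemeasurable n) b.continuous.aestronglyMeasurable]
  rfl

lemma integrable_arctan {Y' : Ω' → ℝ} (hY : AEMeasurable Y' Q) :
    Integrable (fun ω => Real.arctan (Y' ω)) Q := by
  refine Integrable.of_bound (C := Real.pi / 2)
    (Real.continuous_arctan.measurable.comp_aemeasurable hY).aestronglyMeasurable
    (Eventually.of_forall fun x => ?_)
  rw [Real.norm_eq_abs, abs_le]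
  exact ⟨(Real.neg_pi_div_two_lt_arctan _).le, (Real.arctan_lt_pi_div_two _).le⟩

/-- A single test function suffices below: `arctan` is bounded and continuous, strictly increasing
(so it separates ordered variables) and 1-Lipschitz (so errors in its argument carry over). -/
lemma abs_arctan_sub_le (x y : ℝ) : |Real.arctan x - Real.arctan y| ≤ |x - y| := by
  have h : LipschitzWith 1 Real.arctan := by
    refine lipschitzWith_of_nnnorm_deriv_le Real.differentiable_arctan fun x => ?_
    rw [← NNReal.coe_le_coe, coe_nnnorm, Real.deriv_arctan, Real.norm_eq_abs,
      abs_of_nonneg (by positivity), NNReal.coe_one]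
    exact div_le_one_of_le₀ (by nlinarith [sq_nonneg x]) (by positivity)
  simpa [Real.dist_eq] using h.dist_le_mul x y

/-- Two ordered random variables whose bounded increasing transforms have the same expectation
are almost surely equal. -/
lemma ae_eq_of_integral_arctan_eq {Y₁ Y₂ : Ω' → ℝ} (h₁ : AEMeasurable Y₁ Q)
    (h₂ : AEMeasurable Y₂ Q) (hle : ∀ ω, Y₁ ω ≤ Y₂ ω)
    (heq : ∫ ω, Real.arctan (Y₁ ω) ∂Q = ∫ ω, Real.arctan (Y₂ ω) ∂Q) : Y₁ =ᵐ[Q] Y₂ := by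
  have := (integral_eq_iff_of_ae_le (integrable_arctan h₁) (integrable_arctan h₂)
    (Eventually.of_forall fun ω => Real.arctan_strictMono.monotone (hle ω))).1 heq
  filter_upwards [this] with ω hω
  exact Real.arctan_injective hω

/-- A random sequence visits, with positive probability, an open set charged by its weak limit
infinitely often. -/
lemma exists_frequently_mem [l.NeBot] [l.IsCountablyGenerated]
    {Ω₀ : Type*} [MeasurableSpace Ω₀] {P₀ : Measure Ω₀} [IsProbabilityMeasure P₀]
    [TopologicalSpace X] [HasOuterApproxClosed X]
    [MeasurableSpace X] [BorelSpace X] {Z : ι → Ω₀ → X} {Z' : Ω' → X}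
    (hZ : TendstoInDistribution Z l Z' (fun _ => P₀) Q) {U : Set X} (hU : IsOpen U)
    (hpos : Q (Z' ⁻¹' U) ≠ 0) {p : Ω₀ → Prop} (hp : ∀ᵐ ω ∂P₀, p ω) :
    ∃ ω, p ω ∧ ∃ᶠ n in l, Z n ω ∈ U := by
  by_contra! hcon
  -- If almost every path eventually avoided `U`, dominated convergence along a sequence would send
  -- the probabilities of hitting `U` to zero, against portmanteau.
  obtain ⟨u, hu⟩ := exists_seq_tendsto l
  have h1 : ∀ᵐ ω ∂P₀, Tendsto (fun k => (Z (u k) ⁻¹' U).indicator (fun _ => (1 : ℝ≥0∞)) ω) atTop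
      (𝓝 0) := by
    filter_upwards [hp] with ω hω
    have h2 := hu.eventually (hcon ω hω)
    refine tendsto_const_nhds.congr' ?_
    filter_upwards [h2] with k hk
    simp [Set.indicator, hk]
  have h2 : Tendsto (fun k => ∫⁻ ω, (Z (u k) ⁻¹' U).indicator (fun _ => (1 : ℝ≥0∞)) ω ∂P₀) atTop
      (𝓝 (∫⁻ _, 0 ∂P₀)) := by
    refine tendsto_lintegral_of_dominated_convergence' (fun _ => 1) (fun k => ?_) (fun k => ?_)
      (by simp) h1
    · exact aemeasurable_const.indicator₀
        ((hZ.forall_aemeasurable (u k)).nullMeasurableSet_preimage hU.measurableSet)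
    · exact Eventually.of_forall fun ω => Set.indicator_le_self' (by simp) ω
  have h3 : Tendsto (fun k => P₀ (Z (u k) ⁻¹' U)) atTop (𝓝 0) := by
    simp only [lintegral_zero] at h2
    refine h2.congr fun k => ?_
    rw [lintegral_indicator_const₀
      ((hZ.forall_aemeasurable (u k)).nullMeasurableSet_preimage hU.measurableSet), one_mul]
  have h4 := (le_liminf_of_tendstoInDistribution hZ hU).trans
    (liminf_le_liminf_of_le (f := l) (g := map u atTop) hu)
  have h5 : liminf (fun n => P₀ (Z n ⁻¹' U)) (map u atTop) = 0 := h3.liminf_eq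
  rw [h5] at h4
  exact hpos (le_antisymm h4 bot_le)

end Weak

/-- **Delta method** around convergent centers, for strictly differentiable maps. -/
theorem tendstoInDistribution_delta {ι : Type*} {Ω : ι → Type*} {m : ∀ i, MeasurableSpace (Ω i)}
    {P : (i : ι) → Measure (Ω i)} [∀ i, IsProbabilityMeasure (P i)]
    {Ω' : Type*} {m' : MeasurableSpace Ω'} {Q : Measure Ω'} [IsProbabilityMeasure Q]
    {l : Filter ι} [l.IsCountablyGenerated]
    {E F : Type*} [NormedAddCommGroup E] [NormedSpace ℝ E] [MeasurableSpace E] [BorelSpace E]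
    [NormedAddCommGroup F] [NormedSpace ℝ F] [MeasurableSpace F] [BorelSpace F]
    {r : ι → ℝ} (hr : Tendsto r l atTop) {Y : (i : ι) → Ω i → E} {c : ι → E} {y : E}
    (hc : Tendsto c l (𝓝 y)) {Z : Ω' → E}
    (hY : TendstoInDistribution (fun n ω => r n • (Y n ω - c n)) l Z P Q)
    {g : E → F} {g' : E →L[ℝ] F} (hg : HasStrictFDerivAt g g' y) (hgm : Measurable g)
    [SecondCountableTopology F] :
    TendstoInDistribution (fun n ω => r n • (g (Y n ω) - g (c n))) l (fun ω => g' (Z ω)) P Q := by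
  refine tendstoInDistribution_of_tendsto_prod hY (fun n => ?_)
    (g'.continuous.measurable.comp_aemeasurable hY.aemeasurable_limit)
    (fun n z => r n • (g (c n + (r n)⁻¹ • z) - g (c n))) ?_ ?_
  -- Measurability is required at every `n`, while `r n` is positive only eventually. `Y n` can be
  -- recovered from the rescaled variable unless `r n = 0`, when the target is constant.
  · by_cases h0 : r n = 0
    · simp [h0]
    · have h1 := hY.forall_aemeasurable n
      have h2 : AEMeasurable (Y n) (P n) := by
        have h3 : Measurable fun z : E => c n + (r n)⁻¹ • z := Continuous.measurable (by fun_prop)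
        simpa [Function.comp_def, smul_smul, inv_mul_cancel₀ h0] using h3.comp_aemeasurable h1
      exact ((hgm.comp_aemeasurable h2).sub_const _).const_smul _
  · filter_upwards [hr.eventually_gt_atTop 0] with n hn
    simp [smul_smul, inv_mul_cancel₀ hn.ne']
  · refine Eventually.of_forall fun ω => ?_
    have hr1 : Tendsto (fun p : ι × E => (r p.1)⁻¹) (l ×ˢ 𝓝 (Z ω)) (𝓝 0) :=
      (tendsto_inv_atTop_zero.comp hr).comp tendsto_fst
    have hz : Tendsto (fun p : ι × E => p.2) (l ×ˢ 𝓝 (Z ω)) (𝓝 (Z ω)) := tendsto_snd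
    have hc1 : Tendsto (fun p : ι × E => c p.1) (l ×ˢ 𝓝 (Z ω)) (𝓝 y) := hc.comp tendsto_fst
    have h2 : Tendsto (fun p : ι × E => (c p.1 + (r p.1)⁻¹ • p.2, c p.1)) (l ×ˢ 𝓝 (Z ω))
        (𝓝 (y, y)) := by
      refine Tendsto.prodMk_nhds ?_ hc1
      simpa using hc1.add (hr1.smul hz)
    -- Both endpoints of the increment move, hence the need for strict differentiability.
    have h3 := hg.isLittleO.comp_tendsto h2
    have h4 : (fun p : ι × E => r p.1 • (g (c p.1 + (r p.1)⁻¹ • p.2) - g (c p.1)) - g' p.2)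
        =o[l ×ˢ 𝓝 (Z ω)] fun p => p.2 := by
      have h5 := (Asymptotics.isBigO_refl (fun p : ι × E => r p.1) (l ×ˢ 𝓝 (Z ω))).smul_isLittleO h3
      refine h5.congr' ?_ ?_
      all_goals
        filter_upwards [tendsto_fst.eventually (hr.eventually_gt_atTop 0)] with p hp
        simp [smul_sub, smul_smul, mul_inv_cancel₀ hp.ne']
    have h6 : Tendsto (fun p : ι × E => r p.1 • (g (c p.1 + (r p.1)⁻¹ • p.2) - g (c p.1)) - g' p.2)
        (l ×ˢ 𝓝 (Z ω)) (𝓝 0) :=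
      (Asymptotics.isLittleO_one_iff ℝ).1 (h4.trans_isBigO (hz.isBigO_one ℝ))
    simpa using h6.add ((g'.continuous.tendsto (Z ω)).comp hz)

/-! ### Directional differentiability of the `L¹` norm. -/

section DirectionalDerivative

open Classical in
/-- The one-sided directional derivative of the absolute value at `a` in the direction `b`. -/
noncomputable def dirAbs (a b : ℝ) : ℝ := if a = 0 then |b| else if 0 < a then b else -b

lemma measurable_dirAbs : Measurable fun p : ℝ × ℝ => dirAbs p.1 p.2 := by
  unfold dirAbs
  refine Measurable.ite (measurableSet_eq_fun measurable_fst measurable_const) (by fun_prop) ?_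
  exact Measurable.ite (measurableSet_lt measurable_const measurable_fst) (by fun_prop)
    (by fun_prop)

lemma abs_dirAbs (a b : ℝ) : |dirAbs a b| = |b| := by
  unfold dirAbs; split_ifs <;> simp

lemma abs_dirAbs_sub_le (a b c : ℝ) : |dirAbs a b - dirAbs a c| ≤ |b - c| := by
  unfold dirAbs; split_ifs
  · exact abs_abs_sub_abs_le_abs_sub b c
  · rfl
  · rw [neg_sub_neg, abs_sub_comm]

lemma dirAbs_add_le (a b c : ℝ) : dirAbs a (b + c) ≤ dirAbs a b + dirAbs a c := by
  unfold dirAbs; split_ifs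
  · exact abs_add_le b c
  · rfl
  · linarith

/-- Off the kink the sign is eventually fixed and the quotient is eventually equal to its limit. At
`a = 0` a moving center could change the limit, which is excluded by fixing the center or by `b =
0`. -/
lemma tendsto_abs_quotient {ι : Type*} {l : Filter ι} {r : ι → ℝ} (hr : Tendsto r l atTop)
    {u : ι → ℝ} {a b : ℝ} (hu : Tendsto u l (𝓝 a)) (h : (∀ n, u n = a) ∨ (a = 0 → b = 0)) :
    Tendsto (fun n => r n * (|u n + (r n)⁻¹ * b| - |u n|)) l (𝓝 (dirAbs a b)) := by
  have hu2 : Tendsto (fun n => u n + (r n)⁻¹ * b) l (𝓝 a) := by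
    simpa using hu.add ((tendsto_inv_atTop_zero.comp hr).mul_const b)
  have hpos := hr.eventually_gt_atTop 0
  refine tendsto_const_nhds.congr' ?_
  rcases lt_trichotomy a 0 with ha | ha | ha
  · filter_upwards [hpos, hu.eventually_lt_const ha, hu2.eventually_lt_const ha] with n h1 h2 h3
    rw [dirAbs, if_neg ha.ne, if_neg ha.not_gt, abs_of_neg h2, abs_of_neg h3]
    field_simp
    ring
  · filter_upwards [hpos] with n h1
    rcases h with h | h
    · rw [h n, ha, dirAbs, if_pos rfl, zero_add, abs_zero, sub_zero, abs_mul, abs_inv,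
        abs_of_pos h1, mul_inv_cancel_left₀ h1.ne']
    · simp [h ha, dirAbs]
  · filter_upwards [hpos, hu.eventually_const_lt ha, hu2.eventually_const_lt ha] with n h1 h2 h3
    rw [dirAbs, if_neg ha.ne', if_pos ha, abs_of_pos h2, abs_of_pos h3]
    field_simp
    ring

variable {D : Set ℝ}

/-- The one-sided directional derivative of the `L¹` norm at `F` in the direction `H`. -/
noncomputable def normDeriv (F H : L1 D) : ℝ := ∫ t in D, dirAbs (F t) (H t)

lemma integrable_dirAbs {f h : ℝ → ℝ} {μ : Measure ℝ} (hf : AEMeasurable f μ)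
    (hh : Integrable h μ) : Integrable (fun t => dirAbs (f t) (h t)) μ := by
  refine hh.mono (measurable_dirAbs.comp_aemeasurable
    (hf.prodMk hh.1.aemeasurable)).aestronglyMeasurable (Eventually.of_forall fun t => ?_)
  simp only [Real.norm_eq_abs, abs_dirAbs, le_refl]

lemma aemeasurable_coe (F : L1 D) : AEMeasurable F (volume.restrict D) :=
  (Lp.aestronglyMeasurable F).aemeasurable

lemma norm_eq_integral_abs (F : L1 D) : ‖F‖ = ∫ t in D, |F t| := by
  simp [L1.norm_eq_integral_norm]

lemma lipschitzWith_normDeriv (F : L1 D) : LipschitzWith 1 (normDeriv F) := by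
  refine LipschitzWith.of_dist_le_mul fun H K => ?_
  have hH := L1.integrable_coeFn H
  have hK := L1.integrable_coeFn K
  rw [NNReal.coe_one, one_mul, Real.dist_eq, dist_eq_norm, norm_eq_integral_abs, normDeriv,
    normDeriv, ← integral_sub (integrable_dirAbs (aemeasurable_coe F) hH)
      (integrable_dirAbs (aemeasurable_coe F) hK)]
  refine abs_integral_le_integral_abs.trans (integral_mono_ae ?_ ?_ ?_)
  · exact ((integrable_dirAbs (aemeasurable_coe F) hH).sub
      (integrable_dirAbs (aemeasurable_coe F) hK)).abs
  · exact (L1.integrable_coeFn (H - K)).abs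
  · filter_upwards [Lp.coeFn_sub H K] with t ht
    rw [ht]
    exact abs_dirAbs_sub_le _ _ _

lemma integrable_dirAbs_coe (F H : L1 D) :
    Integrable (fun t => dirAbs (F t) (H t)) (volume.restrict D) :=
  integrable_dirAbs (aemeasurable_coe F) (L1.integrable_coeFn H)

/-- This sublinearity supplies the ordering that turns equality of expectations into almost sure
equality. -/
lemma normDeriv_add_le (F H K : L1 D) : normDeriv F (H + K) ≤ normDeriv F H + normDeriv F K := by
  unfold normDeriv
  rw [← integral_add (integrable_dirAbs_coe F H) (integrable_dirAbs_coe F K)]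
  refine integral_mono_ae (integrable_dirAbs_coe F _)
    ((integrable_dirAbs_coe F H).add (integrable_dirAbs_coe F K)) ?_
  filter_upwards [Lp.coeFn_add H K] with t ht
  rw [ht]
  exact dirAbs_add_le _ _ _

/-- If the derivative of the norm is additive at `(H, K)`, then `H` and `K` do not have opposite
signs on the zero set of `F`. -/
lemma ae_abs_add_of_normDeriv_add (F H K : L1 D)
    (h : normDeriv F (H + K) = normDeriv F H + normDeriv F K) :
    ∀ᵐ t ∂volume.restrict D, F t = 0 → |H t + K t| = |H t| + |K t| := by
  unfold normDeriv at h
  rw [← integral_add (integrable_dirAbs_coe F H) (integrable_dirAbs_coe F K)] at h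
  have h' := (integral_eq_iff_of_ae_le (integrable_dirAbs_coe F _)
    ((integrable_dirAbs_coe F H).add (integrable_dirAbs_coe F K)) ?_).1 h
  · filter_upwards [Lp.coeFn_add H K, h'] with t ht h2 h0
    simp only [ht, dirAbs, h0, if_true, Pi.add_apply] at h2
    exact h2
  · filter_upwards [Lp.coeFn_add H K] with t ht
    rw [ht]
    exact dirAbs_add_le _ _ _

/-- The difference quotients of the norm at `F`, with step `1 / r`. -/
noncomputable def normQuotient (r : ℝ) (F H : L1 D) : ℝ := r * (‖F + r⁻¹ • H‖ - ‖F‖)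

/-- The bound is uniform in the step and in the center, so directions may be perturbed at every
scale. -/
lemma abs_normQuotient_sub_le {r : ℝ} (hr : 0 < r) (F H K : L1 D) :
    |normQuotient r F H - normQuotient r F K| ≤ ‖H - K‖ := by
  have h1 : normQuotient r F H - normQuotient r F K
      = r * (‖F + r⁻¹ • H‖ - ‖F + r⁻¹ • K‖) := by unfold normQuotient; ring
  rw [h1, abs_mul, abs_of_pos hr]
  have h2 := abs_norm_sub_norm_le (F + r⁻¹ • H) (F + r⁻¹ • K)
  rw [add_sub_add_left_eq_sub, ← smul_sub, norm_smul, norm_inv, Real.norm_of_nonneg hr.le] at h2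
  calc _ ≤ r * (r⁻¹ * ‖H - K‖) := by gcongr
    _ = _ := by field_simp

lemma normQuotient_eq_integral (r : ℝ) (F H : L1 D) :
    normQuotient r F H = ∫ t in D, r * (|F t + r⁻¹ * H t| - |F t|) := by
  unfold normQuotient
  rw [norm_eq_integral_abs, norm_eq_integral_abs, ← integral_sub
    (L1.integrable_coeFn _).abs (L1.integrable_coeFn _).abs, ← integral_const_mul]
  refine integral_congr_ae ?_
  filter_upwards [Lp.coeFn_add F (r⁻¹ • H), Lp.coeFn_smul r⁻¹ H] with t h1 h2
  simp only [h1, Pi.add_apply, h2, Pi.smul_apply, smul_eq_mul]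

/-- Hadamard directional differentiability of the `L¹` norm at `F`; the center may vary if the
direction vanishes on the zero set of `F`. -/
lemma tendsto_normQuotient {ι : Type*} {l : Filter ι} [l.IsCountablyGenerated] {r : ι → ℝ}
    (hr : Tendsto r l atTop) {u : ι → L1 D} {F H : L1 D} (hu : Tendsto u l (𝓝 F))
    (h : (∀ n, u n = F) ∨ ∀ᵐ t ∂volume.restrict D, F t = 0 → H t = 0) :
    Tendsto (fun n => normQuotient (r n) (u n) H) l (𝓝 (normDeriv F H)) := by
  -- Convergence of the centers in `L¹` gives convergence a.e. only along subsequences. The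
  -- integrands are dominated by `|H|`.
  refine tendsto_of_subseq_tendsto fun ns hns => ?_
  obtain ⟨ms, hms, hae⟩ := (tendstoInMeasure_of_tendsto_Lp (hu.comp hns)).exists_seq_tendsto_ae
  refine ⟨ms, ?_⟩
  have hr' : Tendsto (fun k => r (ns (ms k))) atTop atTop :=
    hr.comp (hns.comp hms.tendsto_atTop)
  simp only [normQuotient_eq_integral]
  refine tendsto_integral_filter_of_dominated_convergence (fun t => |H t|)
    (Eventually.of_forall fun k => ?_) ?_ (L1.integrable_coeFn H).abs ?_
  · have h1 := aemeasurable_coe (u (ns (ms k)))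
    have h2 := aemeasurable_coe H
    exact AEMeasurable.aestronglyMeasurable (by fun_prop)
  · filter_upwards [hr'.eventually_gt_atTop 0] with k hk
    refine Eventually.of_forall fun t => ?_
    rw [Real.norm_eq_abs, abs_mul, abs_of_pos hk]
    have h1 := abs_abs_sub_abs_le_abs_sub (u (ns (ms k)) t + (r (ns (ms k)))⁻¹ * H t)
      (u (ns (ms k)) t)
    rw [add_sub_cancel_left, abs_mul, abs_inv, abs_of_pos hk] at h1
    calc _ ≤ r (ns (ms k)) * ((r (ns (ms k)))⁻¹ * |H t|) := by gcongr
      _ = _ := by field_simp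
  · rcases h with h | h
    · filter_upwards [hae] with t ht
      exact tendsto_abs_quotient hr' ht (Or.inl fun k => by rw [h])
    · filter_upwards [hae, h] with t ht h0
      exact tendsto_abs_quotient hr' ht (Or.inr h0)

lemma tendsto_normQuotient_prod {ι : Type*} {l : Filter ι} [l.IsCountablyGenerated] {r : ι → ℝ}
    (hr : Tendsto r l atTop) {u : ι → L1 D} {F H : L1 D} (hu : Tendsto u l (𝓝 F))
    (h : (∀ n, u n = F) ∨ ∀ᵐ t ∂volume.restrict D, F t = 0 → H t = 0) :
    Tendsto (fun p : ι × L1 D => normQuotient (r p.1) (u p.1) p.2) (l ×ˢ 𝓝 H)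
      (𝓝 (normDeriv F H)) := by
  have h1 : Tendsto (fun p : ι × L1 D => normQuotient (r p.1) (u p.1) H) (l ×ˢ 𝓝 H)
      (𝓝 (normDeriv F H)) := (tendsto_normQuotient hr hu h).comp tendsto_fst
  have h2 : Tendsto (fun p : ι × L1 D =>
      normQuotient (r p.1) (u p.1) p.2 - normQuotient (r p.1) (u p.1) H) (l ×ˢ 𝓝 H) (𝓝 0) := by
    have h3 : Tendsto (fun p : ι × L1 D => ‖p.2 - H‖) (l ×ˢ 𝓝 H) (𝓝 0) :=
      (tendsto_iff_norm_sub_tendsto_zero.1 tendsto_id).comp tendsto_snd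
    refine squeeze_zero_norm' ?_ h3
    filter_upwards [tendsto_fst.eventually (hr.eventually_gt_atTop 0)] with p hp
    exact abs_normQuotient_sub_le hp _ _ _
  simpa using h2.add h1

end DirectionalDerivative

/-! ### Limit law of the index, and what bootstrap consistency forces. -/

section Bootstrap

variable {D : Set ℝ}

/-- The index as a function on `L¹(D)`. -/
noncomputable def indexL1 (F : L1 D) : ℝ × ℝ := (∫ t in D, F t, ‖F‖)

lemma continuous_indexL1 : Continuous (indexL1 (D := D)) :=
  continuous_integral.comp (continuous_id) |>.prodMk continuous_norm

lemma integral_coe_smul_sub (r : ℝ) (F H : L1 D) :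
    ∫ t in D, (r • (F - H) : L1 D) t = r * ((∫ t in D, F t) - ∫ t in D, H t) := by
  rw [← integral_sub (L1.integrable_coeFn F) (L1.integrable_coeFn H), ← integral_const_mul]
  refine integral_congr_ae ?_
  filter_upwards [Lp.coeFn_smul r (F - H), Lp.coeFn_sub F H] with t h1 h2
  rw [h1, Pi.smul_apply, h2, Pi.sub_apply, smul_eq_mul]

lemma continuous_integral_coe : Continuous fun F : L1 D => ∫ t in D, F t :=
  continuous_integral

lemma continuous_normQuotient (r : ℝ) (F : L1 D) : Continuous (normQuotient r F) := by
  unfold normQuotient; fun_prop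

lemma normQuotient_smul_sub {r : ℝ} (hr : r ≠ 0) (F K : L1 D) :
    normQuotient r F (r • (K - F)) = r * (‖K‖ - ‖F‖) := by
  rw [normQuotient, smul_smul, inv_mul_cancel₀ hr, one_smul, add_sub_cancel]

section Limit

variable {ι : Type*} {Ω : ι → Type*} {m : ∀ i, MeasurableSpace (Ω i)}
  {P : (i : ι) → Measure (Ω i)} [∀ i, IsProbabilityMeasure (P i)]
  {Ω' : Type*} {m' : MeasurableSpace Ω'} {Q : Measure Ω'} [IsProbabilityMeasure Q]
  {l : Filter ι} [l.IsCountablyGenerated] {r : ι → ℝ}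

/-- The limit law of the index, with a fixed center, or with a convergent center if the limit of
the process vanishes on the zero set of `F`. -/
theorem tendstoInDistribution_indexL1 (hr : Tendsto r l atTop) {Y : (i : ι) → Ω i → L1 D}
    {c : ι → L1 D} {F : L1 D} (hc : Tendsto c l (𝓝 F)) {W : Ω' → L1 D}
    (hY : TendstoInDistribution (fun n ω => r n • (Y n ω - c n)) l W P Q)
    (h : (∀ n, c n = F) ∨ ∀ᵐ ω ∂Q, ∀ᵐ t ∂volume.restrict D, F t = 0 → W ω t = 0) :
    TendstoInDistribution (fun n ω => r n • (indexL1 (Y n ω) - indexL1 (c n))) l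
      (fun ω => (∫ t in D, W ω t, normDeriv F (W ω))) P Q := by
  have key : ∀ n ω, r n ≠ 0 → r n • (indexL1 (Y n ω) - indexL1 (c n))
      = (∫ t in D, (r n • (Y n ω - c n) : L1 D) t,
        normQuotient (r n) (c n) (r n • (Y n ω - c n))) := fun n ω h0 => by
    rw [integral_coe_smul_sub, normQuotient_smul_sub h0]
    rfl
  refine tendstoInDistribution_of_tendsto_prod hY (fun n => ?_) ?_
    (fun n H => (∫ t in D, H t, normQuotient (r n) (c n) H)) ?_ ?_
  · by_cases h0 : r n = 0
    · simp [h0]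
    · simp only [key n _ h0]
      exact ((continuous_integral_coe.prodMk
        (continuous_normQuotient _ _)).measurable).comp_aemeasurable (hY.forall_aemeasurable n)
  · exact (continuous_integral_coe.prodMk
      (lipschitzWith_normDeriv F).continuous).measurable.comp_aemeasurable hY.aemeasurable_limit
  · filter_upwards [hr.eventually_gt_atTop 0] with n hn
    exact Eventually.of_forall fun ω => key n ω hn.ne'
  · have h' : ∀ᵐ ω ∂Q, (∀ n, c n = F) ∨ ∀ᵐ t ∂volume.restrict D, F t = 0 → W ω t = 0 := by
      rcases h with h | h
      · exact Eventually.of_forall fun _ => Or.inl h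
      · exact h.mono fun _ => Or.inr
    filter_upwards [h'] with ω hω
    exact ((continuous_integral_coe.tendsto (W ω)).comp tendsto_snd).prodMk_nhds
      (tendsto_normQuotient_prod hr hc hω)

end Limit

/-- If the bootstrap of the norm is consistent, then the derivative of the norm is additive on
independent copies of the limiting process. -/
theorem normDeriv_additive_of_bootstrap
    {ι : Type*} {l : Filter ι} [l.NeBot] [l.IsCountablyGenerated] {r : ι → ℝ}
    (hr : Tendsto r l atTop)
    {Ω : Type*} [MeasurableSpace Ω] {P : Measure Ω} [IsProbabilityMeasure P]
    {Ω' : Type*} [MeasurableSpace Ω'] {Q : Measure Ω'} [IsProbabilityMeasure Q]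
    {Ωb : ι → Type*} [∀ i, MeasurableSpace (Ωb i)] {B : (i : ι) → Ω → Measure (Ωb i)}
    [∀ i ω, IsProbabilityMeasure (B i ω)]
    {Fh : ι → Ω → L1 D} {Fb : (i : ι) → Ωb i → L1 D} {F : L1 D} {W : Ω' → L1 D} {α : ℝ}
    (hG : TendstoInDistribution (fun n ω => r n • (Fh n ω - F)) l W (fun _ => P) Q)
    (hH : ∀ᵐ ω ∂P,
      TendstoInDistribution (fun n x => r n • (Fb n x - Fh n ω)) l W (fun n => B n ω) Q)
    (hα : ∀ᵐ ω ∂P, Tendsto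
      (fun n => ∫ x, Real.arctan (r n * (‖Fb n x‖ - ‖Fh n ω‖)) ∂(B n ω)) l (𝓝 α))
    (hlim : α = ∫ ω, Real.arctan (normDeriv F (W ω)) ∂Q) :
    ∀ᵐ ω₁ ∂Q, ∀ᵐ ω₂ ∂Q,
      normDeriv F (W ω₁ + W ω₂) = normDeriv F (W ω₁) + normDeriv F (W ω₂) := by
  have hW := hG.aemeasurable_limit
  -- Makes `L¹` separable, so that the law of `W` is carried by its support.
  have : Fact ((1 : ℝ≥0∞) ≠ ⊤) := ⟨ENNReal.one_ne_top⟩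
  have hsupp : ∀ᵐ ω ∂Q, W ω ∈ (Q.map W).support :=
    ae_of_ae_map hW Measure.support_mem_ae
  filter_upwards [hsupp] with ω₁ hω₁
  set h := W ω₁ with hh
  have hcont := (lipschitzWith_normDeriv F).continuous
  have m1 : AEMeasurable (fun ω => normDeriv F (h + W ω) - normDeriv F h) Q :=
    ((hcont.comp (continuous_const.add continuous_id)).sub
      continuous_const).measurable.comp_aemeasurable hW
  have m2 : AEMeasurable (fun ω => normDeriv F (W ω)) Q := hcont.measurable.comp_aemeasurable hW
  have heq : ∫ ω, Real.arctan (normDeriv F (h + W ω) - normDeriv F h) ∂Q = α := by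
    refine eq_of_abs_sub_le_all fun ε hε => ?_
    -- The radius is `ε / 2` because replacing `h` by the data term costs their distance twice, once
    -- in each quotient.
    have hpos : Q (W ⁻¹' Metric.ball h (ε / 2)) ≠ 0 := by
      rw [← Measure.map_apply_of_aemeasurable hW Metric.isOpen_ball.measurableSet]
      exact ((Measure.mem_support_iff_forall h).1 hω₁ _
        (Metric.ball_mem_nhds h (half_pos hε))).ne'
    obtain ⟨ω, ⟨hω1, hω2⟩, hfreq⟩ :=
      exists_frequently_mem hG Metric.isOpen_ball hpos (hH.and hα)
    have hV : TendstoInDistribution (fun n x => normQuotient (r n) F (h + r n • (Fb n x - Fh n ω))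
        - normQuotient (r n) F h) l (fun ω => normDeriv F (h + W ω) - normDeriv F h)
        (fun n => B n ω) Q := by
      refine tendstoInDistribution_of_tendsto_prod hω1 (fun n => ?_) m1
        (fun n H => normQuotient (r n) F (h + H) - normQuotient (r n) F h)
        (Eventually.of_forall fun n => Eventually.of_forall fun x => rfl)
        (Eventually.of_forall fun ω₂ => ?_)
      · exact (((continuous_normQuotient (r n) F).comp (continuous_const.add continuous_id)).sub
          continuous_const).measurable.comp_aemeasurable (hω1.forall_aemeasurable n)
      · refine Tendsto.sub ?_ ?_
        · have h1 : Tendsto (fun p : ι × L1 D => (p.1, h + p.2)) (l ×ˢ 𝓝 (W ω₂))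
              (l ×ˢ 𝓝 (h + W ω₂)) :=
            tendsto_fst.prodMk (tendsto_snd.const_add h)
          exact (tendsto_normQuotient_prod hr (tendsto_const_nhds (x := F))
            (Or.inl fun _ => rfl)).comp h1
        · exact (tendsto_normQuotient hr (tendsto_const_nhds (x := F))
            (Or.inl fun _ => rfl)).comp tendsto_fst
    have hV' := ((tendsto_integral_arctan hV).sub hω2).abs
    -- Both limits exist along `l`, so a bound at infinitely many `n` is enough.
    refine le_of_tendsto_of_frequently hV' ?_
    refine (hfreq.and_eventually (hr.eventually_gt_atTop 0)).mono fun n hn => ?_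
    obtain ⟨hball, hrn⟩ := hn
    have hT : ∀ x, r n * (‖Fb n x‖ - ‖Fh n ω‖)
        = normQuotient (r n) F (r n • (Fh n ω - F) + r n • (Fb n x - Fh n ω))
          - normQuotient (r n) F (r n • (Fh n ω - F)) := fun x => by
      have h1 : r n • (Fh n ω - F) + r n • (Fb n x - Fh n ω) = r n • (Fb n x - F) := by
        rw [← smul_add, add_comm, sub_add_sub_cancel]
      rw [h1, normQuotient_smul_sub hrn.ne', normQuotient_smul_sub hrn.ne']
      ring
    have hdist : ‖h - r n • (Fh n ω - F)‖ < ε / 2 := by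
      rw [← dist_eq_norm, dist_comm]; exact hball
    have hTm : AEMeasurable (fun x => r n * (‖Fb n x‖ - ‖Fh n ω‖)) (B n ω) := by
      have h1 : Continuous fun H => normQuotient (r n) F (r n • (Fh n ω - F) + H)
          - normQuotient (r n) F (r n • (Fh n ω - F)) :=
        ((continuous_normQuotient (r n) F).comp (continuous_const.add continuous_id)).sub
          continuous_const
      exact (h1.measurable.comp_aemeasurable (hω1.forall_aemeasurable n)).congr
        (Eventually.of_forall fun x => (hT x).symm)
    rw [← integral_sub (integrable_arctan (hV.forall_aemeasurable n)) (integrable_arctan hTm)]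
    suffices hx : ∀ x, ‖Real.arctan (normQuotient (r n) F (h + r n • (Fb n x - Fh n ω))
        - normQuotient (r n) F h) - Real.arctan (r n * (‖Fb n x‖ - ‖Fh n ω‖))‖ ≤ ε by
      simpa using norm_integral_le_of_norm_le_const (μ := B n ω) (Eventually.of_forall hx)
    intro x
    refine (abs_arctan_sub_le _ _).trans ?_
    rw [hT]
    have e1 := abs_normQuotient_sub_le hrn F (h + r n • (Fb n x - Fh n ω))
      (r n • (Fh n ω - F) + r n • (Fb n x - Fh n ω))
    rw [add_sub_add_right_eq_sub] at e1
    have e2 := abs_normQuotient_sub_le hrn F h (r n • (Fh n ω - F))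
    rw [abs_le] at e1 e2 ⊢
    constructor <;> linarith [e1.1, e1.2, e2.1, e2.2]
  have hae := ae_eq_of_integral_arctan_eq m1 m2
    (fun ω => by linarith [normDeriv_add_le F h (W ω)]) (heq.trans hlim)
  filter_upwards [hae] with ω₂ hω₂
  linarith

end Bootstrap

/-! ### Sign rigidity of Gaussian variables, and exchange of null sets. -/

section Gaussian

variable {Ω' : Type*} [MeasurableSpace Ω'] {Q : Measure Ω'}

/-- A Gaussian variable that never has the sign opposite to that of an independent copy is
almost surely constant. -/
lemma ae_eq_const_of_gaussian {Y : Ω' → ℝ} (hY : HasGaussianLaw Y Q)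
    (h : ∀ᵐ ω₁ ∂Q, ∀ᵐ ω₂ ∂Q, |Y ω₁ + Y ω₂| = |Y ω₁| + |Y ω₂|) : ∃ c : ℝ, Y =ᵐ[Q] fun _ => c := by
  have hm := hY.aemeasurable
  have hlaw := hY.map_eq_gaussianReal
  set v := (Var[Y; Q]).toNNReal
  by_cases hv : v = 0
  · refine ⟨∫ ω, Y ω ∂Q, ?_⟩
    rw [hv, gaussianReal_zero_var] at hlaw
    refine ae_of_ae_map hm (p := fun y => y = ∫ ω, Y ω ∂Q) ?_
    rw [hlaw, ae_dirac_eq]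
    exact rfl
  · have hac := gaussianReal_absolutelyContinuous' (∫ ω, Y ω ∂Q) hv
    rw [← hlaw] at hac
    -- With positive variance, Lebesgue measure is absolutely continuous with respect to the law, so
    -- every nonempty open set is charged.
    have hfreq : ∀ U : Set ℝ, IsOpen U → U.Nonempty → ∃ᶠ ω in ae Q, Y ω ∈ U := by
      intro U hU hne
      rw [frequently_ae_iff]
      intro h0
      refine hU.measure_ne_zero volume hne (hac ?_)
      rw [Measure.map_apply_of_aemeasurable hm hU.measurableSet]
      exact h0
    obtain ⟨ω₁, h1, h2⟩ := ((hfreq (Set.Ioi 0) isOpen_Ioi ⟨1, by simp⟩).and_eventually h).exists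
    obtain ⟨ω₂, h3, h4⟩ := ((hfreq (Set.Iio 0) isOpen_Iio ⟨-1, by simp⟩).and_eventually h2).exists
    exfalso
    simp only [Set.mem_Ioi, Set.mem_Iio] at h1 h3
    rw [abs_of_pos h1, abs_of_neg h3] at h4
    rcases abs_cases (Y ω₁ + Y ω₂) with h5 | h5 <;> linarith [h5.1]

/-- Exchange of three almost-everywhere quantifiers. -/
lemma ae_ae_comm_of_pair [SFinite Q] {μ : Measure ℝ} [SFinite μ] {p : ℝ → Ω' → Ω' → Prop}
    (hp : MeasurableSet {z : ℝ × (Ω' × Ω') | p z.1 z.2.1 z.2.2})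
    (h : ∀ᵐ ω₁ ∂Q, ∀ᵐ ω₂ ∂Q, ∀ᵐ t ∂μ, p t ω₁ ω₂) : ∀ᵐ t ∂μ, ∀ᵐ ω₁ ∂Q, ∀ᵐ ω₂ ∂Q, p t ω₁ ω₂ := by
  have hms : MeasurableSet {z : Ω' × Ω' | ∀ᵐ t ∂μ, p t z.1 z.2} := by
    have h1 : Measurable fun z : Ω' × Ω' => μ ((fun t => (t, z)) ⁻¹' {z : ℝ × (Ω' × Ω') |
      p z.1 z.2.1 z.2.2}ᶜ) := measurable_measure_prodMk_right hp.compl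
    exact h1 (measurableSet_singleton 0)
  have h2 : ∀ᵐ z ∂(Q.prod Q), ∀ᵐ t ∂μ, p t z.1 z.2 := (Measure.ae_prod_iff_ae_ae hms).2 h
  have h3 : ∀ᵐ t ∂μ, ∀ᵐ z ∂(Q.prod Q), p t z.1 z.2 :=
    (Measure.ae_ae_comm (p := fun (t : ℝ) (z : Ω' × Ω') => p t z.1 z.2) hp).2 h2
  filter_upwards [h3] with t ht
  exact Measure.ae_ae_of_ae_prod ht

end Gaussian

/-! ### From functions to `L¹` classes; smooth functions of the index. -/

section Bridge

variable {D : Set ℝ}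

lemma coeFn_toL1 {f : ℝ → ℝ} (hf : Integrable f (volume.restrict D)) :
    toL1 D f =ᵐ[volume.restrict D] f := by
  rw [toL1, dif_pos hf]
  exact hf.coeFn_toL1

lemma toL1_mul_sub (r : ℝ) {a b : ℝ → ℝ} (ha : Integrable a (volume.restrict D))
    (hb : Integrable b (volume.restrict D)) :
    toL1 D (fun t => r * (a t - b t)) = r • (toL1 D a - toL1 D b) := by
  have h := (ha.sub hb).const_mul r
  rw [toL1, dif_pos (by exact h), toL1, dif_pos ha, toL1, dif_pos hb, ← Integrable.toL1_sub,
    ← Integrable.toL1_smul]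
  rfl

lemma norm_toL1_sub {a b : ℝ → ℝ} (ha : Integrable a (volume.restrict D))
    (hb : Integrable b (volume.restrict D)) :
    ‖toL1 D a - toL1 D b‖ = ∫ t in D, |a t - b t| := by
  rw [norm_eq_integral_abs]
  refine integral_congr_ae ?_
  filter_upwards [Lp.coeFn_sub (toL1 D a) (toL1 D b), coeFn_toL1 ha, coeFn_toL1 hb] with t h h1 h2
  rw [h, Pi.sub_apply, h1, h2]

lemma index_eq_indexL1 {f g : ℝ → ℝ} (h : Integrable (diff f g) (volume.restrict D)) :
    index D f g = indexL1 (toL1 D (diff f g)) := by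
  rw [index, indexL1, norm_eq_integral_abs]
  congr 1
  · refine integral_congr_ae ?_
    filter_upwards [coeFn_toL1 h] with t ht
    rw [ht, diff]
  · refine integral_congr_ae ?_
    filter_upwards [coeFn_toL1 h] with t ht
    rw [ht, diff]

/-- If the violation ratio is positive, then the two functions differ. -/
lemma index_snd_ne_zero_of_mvr_pos {f g : ℝ → ℝ}
    (h : Integrable (diff f g) (volume.restrict D)) (hpos : 0 < mvr D f g) :
    (index D f g).2 ≠ 0 := by
  intro h0
  have h0' : ∫ t in D, |f t - g t| = 0 := h0
  have hae := (integral_eq_zero_iff_of_nonneg (fun _ => abs_nonneg _) h.abs).1 h0'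
  -- If the functions agree a.e., `ε = 0` is admissible and the infimum is not positive.
  refine hpos.not_ge (csInf_le ⟨0, fun ε hε => hε.1.1⟩ ⟨⟨le_rfl, zero_le_one⟩, ?_⟩)
  rw [AlmostDominated, zero_mul]
  refine le_of_eq (integral_eq_zero_of_ae ?_)
  refine ae_restrict_of_ae_restrict_of_subset (t := D) (fun t ht => ht.1) ?_
  filter_upwards [hae] with t ht
  have : f t - g t = 0 := abs_eq_zero.1 ht
  simp only [Pi.zero_apply]
  linarith

lemma measurable_gfun : Measurable gfun := by
  unfold gfun; fun_prop

lemma hasStrictFDerivAt_gfun {y : ℝ × ℝ} (hy : y.2 ≠ 0) :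
    HasStrictFDerivAt gfun (fderiv ℝ gfun y) y := by
  have h : ContDiffAt ℝ 1 gfun y :=
    (contDiffAt_const.sub (contDiffAt_fst.div contDiffAt_snd hy)).div_const 2
  exact h.hasStrictFDerivAt one_ne_zero

variable {Ω : Type*} [MeasurableSpace Ω] {P : Measure Ω} [IsProbabilityMeasure P]
  {μ₁ μ₂ : Measure ℝ} {X₁ X₂ : ℕ → Ω → ℝ} {s : Measure ℝ → ℝ → ℝ}
  {l : Filter (ℕ+ × ℕ+)} [l.IsCountablyGenerated] {r : ℕ+ × ℕ+ → ℝ}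

/-- Consistency of the bootstrap is preserved by maps that are strictly differentiable at the true
value. -/
theorem IsBootstrapConsistent.comp_hasStrictFDerivAt
    {E F : Type*} [NormedAddCommGroup E] [NormedSpace ℝ E] [MeasurableSpace E] [BorelSpace E]
    [NormedAddCommGroup F] [NormedSpace ℝ F] [MeasurableSpace F] [BorelSpace F]
    [SecondCountableTopology F] {T : (ℝ → ℝ) → (ℝ → ℝ) → E} (hr : Tendsto r l atTop)
    (h : IsBootstrapConsistent P X₁ X₂ μ₁ μ₂ s l r T)
    (hT : ∀ᵐ ω ∂P, Tendsto (fun n => plugIn s T (sample X₁ X₂ n ω)) l (𝓝 (T (s μ₁) (s μ₂))))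
    {g : E → F} {g' : E →L[ℝ] F} (hg : HasStrictFDerivAt g g' (T (s μ₁) (s μ₂)))
    (hgm : Measurable g) :
    IsBootstrapConsistent P X₁ X₂ μ₁ μ₂ s l r (fun a b => g (T a b)) := by
  obtain ⟨ν, h1, h2⟩ := h
  have hm : AEMeasurable (fun y => g' (id y)) (ν : Measure E) :=
    g'.continuous.measurable.aemeasurable
  have : IsProbabilityMeasure ((ν : Measure E).map fun y => g' (id y)) :=
    Measure.isProbabilityMeasure_map hm
  refine ⟨⟨(ν : Measure E).map fun y => g' (id y), inferInstance⟩, ?_, ?_⟩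
  · exact (tendstoInDistribution_id_iff hm).2
      (tendstoInDistribution_delta hr tendsto_const_nhds h1 hg hgm)
  · filter_upwards [h2, hT] with ω hω hTω
    exact (tendstoInDistribution_id_iff hm).2 (tendstoInDistribution_delta hr hTω hω hg hgm)

end Bridge

end StochDom

/-! ### The equivalence and its consequence for the violation ratio. -/

theorem theorem2
    {Ω : Type*} [MeasurableSpace Ω] (P : Measure Ω) [IsProbabilityMeasure P]
    {Ω' : Type*} [MeasurableSpace Ω'] (Q : Measure Ω') [IsProbabilityMeasure Q]
    -- the two populations and two mutually independent random samples
    (μ₁ μ₂ : Measure ℝ) (X₁ X₂ : ℕ → Ω → ℝ)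
    (hX₁ : ∀ i, HasLaw (X₁ i) μ₁ P) (hX₂ : ∀ i, HasLaw (X₂ i) μ₂ P)
    (hindep : iIndepFun (Sum.elim X₁ X₂ : ℕ ⊕ ℕ → Ω → ℝ) P)
    -- the domain and the target function, as a functional of the distribution
    (D : Set ℝ) (hD : MeasurableSet D) (s : Measure ℝ → ℝ → ℝ)
    -- all the differences of target functions are in `L¹(D)`
    (hs : Integrable (StochDom.diff (s μ₁) (s μ₂)) (volume.restrict D))
    (hs_hat : ∀ᵐ ω ∂P, ∀ n, Integrable
      (StochDom.plugIn s StochDom.diff (StochDom.sample X₁ X₂ n ω)) (volume.restrict D))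
    (hs_boot : ∀ᵐ ω ∂P, ∀ n, ∀ᵐ x ∂(StochDom.bootLaw (StochDom.sample X₁ X₂ n ω)),
      Integrable (StochDom.plugIn s StochDom.diff x) (volume.restrict D))
    -- the way in which `n₁, n₂ → ∞`, and the normalization
    (l : Filter (ℕ+ × ℕ+)) [l.NeBot] [l.IsCountablyGenerated] (hl : l ≤ atTop)
    (r : ℕ+ × ℕ+ → ℝ) (hr : Tendsto r l atTop)
    -- strong consistency of `ŝ₁ - ŝ₂` in `L¹(D)`
    (hcons : ∀ᵐ ω ∂P, Tendsto (fun n => ∫ t in D,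
      |StochDom.plugIn s StochDom.diff (StochDom.sample X₁ X₂ n ω) t
        - StochDom.diff (s μ₁) (s μ₂) t|) l (𝓝 0))
    -- the Gaussian process `S`, with paths in `L¹(D)`
    (S : ℝ → Ω' → ℝ) (hS_meas : Measurable (fun p : ℝ × Ω' => S p.1 p.2))
    (hS_int : ∀ᵐ ω' ∂Q, Integrable (fun t => S t ω') (volume.restrict D))
    (hS_gauss : IsGaussianProcess (fun t : D => S t) Q)
    -- no `S t` is a nonzero constant (automatic if `S` is centred)
    (hS_const : ∀ t ∈ D, ∀ c : ℝ, (S t =ᵐ[Q] fun _ => c) → c = 0)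
    -- weak convergence in `L¹(D)` of `r (ŝ₁ - ŝ₂ - (s₁ - s₂))` to `S`
    (hconv : TendstoInDistribution
      (fun n ω => StochDom.toL1 D (fun t => r n *
        (StochDom.plugIn s StochDom.diff (StochDom.sample X₁ X₂ n ω) t
          - StochDom.diff (s μ₁) (s μ₂) t)))
      l (fun ω' => StochDom.toL1 D (fun t => S t ω')) (fun _ => P) Q)
    -- conditionally on the data, a.s., weak convergence in `L¹(D)` of the bootstrap process to `S`
    (hboot : ∀ᵐ ω ∂P, TendstoInDistribution
      (fun n x => StochDom.toL1 D (fun t => r n *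
        (StochDom.plugIn s StochDom.diff x t
          - StochDom.plugIn s StochDom.diff (StochDom.sample X₁ X₂ n ω) t)))
      l (fun ω' => StochDom.toL1 D (fun t => S t ω'))
      (fun n => StochDom.bootLaw (StochDom.sample X₁ X₂ n ω)) Q) :
    (volume {t ∈ D ∩ StochDom.processSupport Q D S | s μ₁ t = s μ₂ t} = 0 ↔
      StochDom.IsBootstrapConsistent P X₁ X₂ μ₁ μ₂ s l r (StochDom.index D)) ∧
    (volume {t ∈ D ∩ StochDom.processSupport Q D S | s μ₁ t = s μ₂ t} = 0 →
      0 < StochDom.mvr D (s μ₁) (s μ₂) →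
      StochDom.IsBootstrapConsistent P X₁ X₂ μ₁ μ₂ s l r
        (fun f g => StochDom.gfun (StochDom.index D f g))) := by
  set F : StochDom.L1 D := StochDom.toL1 D (StochDom.diff (s μ₁) (s μ₂)) with hF
  set Fh : ℕ+ × ℕ+ → Ω → StochDom.L1 D := fun n ω =>
    StochDom.toL1 D (StochDom.plugIn s StochDom.diff (StochDom.sample X₁ X₂ n ω)) with hFh
  set Fb : (n : ℕ+ × ℕ+) → StochDom.SamplePair n → StochDom.L1 D := fun n x =>
    StochDom.toL1 D (StochDom.plugIn s StochDom.diff x) with hFb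
  set W : Ω' → StochDom.L1 D := fun ω' => StochDom.toL1 D (fun t => S t ω') with hW
  have hG : TendstoInDistribution (fun n ω => r n • (Fh n ω - F)) l W (fun _ => P) Q := by
    refine hconv.congr (fun n => ?_) (ae_eq_refl _)
    filter_upwards [hs_hat] with ω hω
    exact StochDom.toL1_mul_sub (r n) (hω n) hs
  have hH : ∀ᵐ ω ∂P, TendstoInDistribution (fun n x => r n • (Fb n x - Fh n ω)) l W
      (fun n => StochDom.bootLaw (StochDom.sample X₁ X₂ n ω)) Q := by
    filter_upwards [hboot, hs_hat, hs_boot] with ω h1 h2 h3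
    refine h1.congr (fun n => ?_) (ae_eq_refl _)
    filter_upwards [h3 n] with x hx
    exact StochDom.toL1_mul_sub (r n) hx (h2 n)
  have hFlim : ∀ᵐ ω ∂P, Tendsto (fun n => Fh n ω) l (𝓝 F) := by
    filter_upwards [hcons, hs_hat] with ω h1 h2
    refine tendsto_iff_norm_sub_tendsto_zero.2 (h1.congr fun n => ?_)
    exact (StochDom.norm_toL1_sub (h2 n) hs).symm
  have hidx_hat : ∀ᵐ ω ∂P, ∀ n, StochDom.plugIn s (StochDom.index D) (StochDom.sample X₁ X₂ n ω)
      = StochDom.indexL1 (Fh n ω) := by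
    filter_upwards [hs_hat] with ω hω n
    exact StochDom.index_eq_indexL1 (hω n)
  have hidx : StochDom.index D (s μ₁) (s μ₂) = StochDom.indexL1 F := StochDom.index_eq_indexL1 hs
  have hidx_boot : ∀ᵐ ω ∂P, ∀ n, ∀ᵐ x ∂(StochDom.bootLaw (StochDom.sample X₁ X₂ n ω)),
      StochDom.plugIn s (StochDom.index D) x = StochDom.indexL1 (Fb n x) := by
    filter_upwards [hs_boot] with ω hω n
    filter_upwards [hω n] with x hx
    exact StochDom.index_eq_indexL1 hx
  set V : Ω' → ℝ × ℝ := fun ω => (∫ t in D, W ω t, StochDom.normDeriv F (W ω)) with hV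
  -- The center is fixed here, so no condition on the contact set is needed.
  have hest : TendstoInDistribution
      (fun n ω => r n • (StochDom.plugIn s (StochDom.index D) (StochDom.sample X₁ X₂ n ω)
        - StochDom.index D (s μ₁) (s μ₂))) l V (fun _ => P) Q := by
    refine (StochDom.tendstoInDistribution_indexL1 hr (tendsto_const_nhds (x := F)) hG
      (Or.inl fun _ => rfl)).congr (fun n => ?_) (ae_eq_refl _)
    filter_upwards [hidx_hat] with ω hω
    rw [hω n, hidx]
  have hVm := hest.aemeasurable_limit
  have hFcoe : ∀ᵐ t ∂volume.restrict D, F t = s μ₁ t - s μ₂ t := StochDom.coeFn_toL1 hs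
  -- Fubini needs a measurable contact set; `s₁ - s₂` is only a.e. measurable, but its
  -- representative `F` is measurable.
  have hzero : MeasurableSet {t : ℝ | F t = 0} :=
    (Lp.stronglyMeasurable F).measurable (measurableSet_singleton 0)
  have hWcoe : ∀ᵐ ω' ∂Q, ∀ᵐ t ∂volume.restrict D, W ω' t = S t ω' := by
    filter_upwards [hS_int] with ω' hω'
    exact StochDom.coeFn_toL1 hω'
  have hcond : volume {t ∈ D ∩ StochDom.processSupport Q D S | s μ₁ t = s μ₂ t} = 0 ↔
      ∀ᵐ t ∂volume.restrict D, F t = 0 → S t =ᵐ[Q] 0 := by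
    have h1 : volume {t ∈ D ∩ StochDom.processSupport Q D S | s μ₁ t = s μ₂ t} = 0 ↔
        ∀ᵐ t ∂volume.restrict D, s μ₁ t = s μ₂ t → S t =ᵐ[Q] 0 := by
      rw [ae_restrict_iff' hD, ae_iff]
      refine Eq.congr (congrArg _ ?_) rfl
      ext t
      simp only [StochDom.processSupport, Set.mem_ofPred_eq, Set.mem_inter_iff]
      tauto
    rw [h1]
    refine eventually_congr ?_
    filter_upwards [hFcoe] with t ht
    rw [ht, sub_eq_zero]
  have hab : volume {t ∈ D ∩ StochDom.processSupport Q D S | s μ₁ t = s μ₂ t} = 0 →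
      StochDom.IsBootstrapConsistent P X₁ X₂ μ₁ μ₂ s l r (StochDom.index D) := by
    intro ha
    have hvanish : ∀ᵐ ω ∂Q, ∀ᵐ t ∂volume.restrict D, F t = 0 → W ω t = 0 := by
      have h1 : ∀ᵐ t ∂volume.restrict D, ∀ᵐ ω ∂Q, F t = 0 → S t ω = 0 := by
        filter_upwards [hcond.1 ha] with t ht
        by_cases h0 : F t = 0
        · filter_upwards [ht h0] with ω hω _
          exact hω
        · exact Eventually.of_forall fun _ h => absurd h h0
      have hms : MeasurableSet {z : ℝ × Ω' | F z.1 = 0 → S z.1 z.2 = 0} := by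
        have h2 : MeasurableSet {z : ℝ × Ω' | F z.1 = 0} := measurable_fst hzero
        have h3 : MeasurableSet {z : ℝ × Ω' | S z.1 z.2 = 0} :=
          hS_meas (measurableSet_singleton 0)
        exact h2.imp h3
      filter_upwards [(Measure.ae_ae_comm hms).1 h1, hWcoe] with ω h4 h5
      filter_upwards [h4, h5] with t h6 h7
      rwa [h7]
    have : IsProbabilityMeasure (Q.map V) := Measure.isProbabilityMeasure_map hVm
    refine ⟨⟨Q.map V, inferInstance⟩, (StochDom.tendstoInDistribution_id_iff hVm).2 hest, ?_⟩
    filter_upwards [hH, hFlim, hidx_hat, hidx_boot] with ω h1 h2 h3 h4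
    refine (StochDom.tendstoInDistribution_id_iff hVm).2
      ((StochDom.tendstoInDistribution_indexL1 hr h2 h1 (Or.inr hvanish)).congr
        (fun n => ?_) (ae_eq_refl _))
    filter_upwards [h4 n] with x hx
    rw [hx, h3 n]
  refine ⟨⟨hab, ?_⟩, fun ha hpos => ?_⟩
  · rintro ⟨ν, h1, h2⟩
    have hα : ∀ᵐ ω ∂P, Tendsto
        (fun n => ∫ x, Real.arctan (r n * (‖Fb n x‖ - ‖Fh n ω‖))
          ∂(StochDom.bootLaw (StochDom.sample X₁ X₂ n ω))) l
        (𝓝 (∫ y : ℝ × ℝ, Real.arctan y.2 ∂(ν : Measure (ℝ × ℝ)))) := by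
      filter_upwards [h2, hidx_hat, hidx_boot] with ω h3 h4 h5
      refine (StochDom.tendsto_integral_arctan (h3.continuous_comp continuous_snd)).congr
        fun n => integral_congr_ae ?_
      filter_upwards [h5 n] with x hx
      simp only [Function.comp_apply, hx, h4 n]
      rfl
    -- Consistency only asserts some common limit `ν`; uniqueness of limits ties its second
    -- marginal, tested on `arctan`, to `normDeriv F W`.
    have hlim := tendsto_nhds_unique
      (StochDom.tendsto_integral_arctan (h1.continuous_comp continuous_snd))
      (StochDom.tendsto_integral_arctan (hest.continuous_comp continuous_snd))
    have hadd := StochDom.normDeriv_additive_of_bootstrap hr hG hH hα hlim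
    have hsign : ∀ᵐ ω₁ ∂Q, ∀ᵐ ω₂ ∂Q, ∀ᵐ t ∂volume.restrict D,
        F t = 0 → |S t ω₁ + S t ω₂| = |S t ω₁| + |S t ω₂| := by
      filter_upwards [hadd, hWcoe] with ω₁ h3 h4
      filter_upwards [h3, hWcoe] with ω₂ h5 h6
      filter_upwards [StochDom.ae_abs_add_of_normDeriv_add F _ _ h5, h4, h6] with t h7 h8 h9
      rwa [← h8, ← h9]
    have hms : MeasurableSet {z : ℝ × (Ω' × Ω') | F z.1 = 0 →
        |S z.1 z.2.1 + S z.1 z.2.2| = |S z.1 z.2.1| + |S z.1 z.2.2|} := by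
      have h3 : MeasurableSet {z : ℝ × (Ω' × Ω') | F z.1 = 0} := measurable_fst hzero
      have m1 : Measurable fun z : ℝ × (Ω' × Ω') => S z.1 z.2.1 :=
        hS_meas.comp (measurable_fst.prodMk (measurable_fst.comp measurable_snd))
      have m2 : Measurable fun z : ℝ × (Ω' × Ω') => S z.1 z.2.2 :=
        hS_meas.comp (measurable_fst.prodMk (measurable_snd.comp measurable_snd))
      exact h3.imp (measurableSet_eq_fun (m1.add m2).abs (m1.abs.add m2.abs))
    refine hcond.2 ?_
    filter_upwards [StochDom.ae_ae_comm_of_pair hms hsign, ae_restrict_mem hD] with t ht htD h0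
    obtain ⟨c, hc⟩ := StochDom.ae_eq_const_of_gaussian (hS_gauss.hasGaussianLaw_eval ⟨t, htD⟩)
      (ht.mono fun ω₁ h => h.mono fun ω₂ h' => h' h0)
    have hc0 := hS_const t htD c hc
    rw [hc0] at hc
    exact hc
  · refine (hab ha).comp_hasStrictFDerivAt hr ?_ (StochDom.hasStrictFDerivAt_gfun
      (StochDom.index_snd_ne_zero_of_mvr_pos hs hpos)) StochDom.measurable_gfun
    filter_upwards [hFlim, hidx_hat] with ω h1 h2
    rw [hidx]
    exact ((StochDom.continuous_indexL1.tendsto F).comp h1).congr fun n => (h2 n).symm
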